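/- **Setting.** Sensors $k$ and times $t$ range over $\mathbb Z_+=\{1,2,\dots\}$; $X_{k,t}$ is the observation of sensor $k$ at time $t$ and $A_t\subseteq\mathbb Z_+$ the random set of active sensors. Let $\mathcal X_{t}=(X_{k,s})_{k\in A_s,\,s\le t}$, $\mathbf A_t=(A_s)_{s\le t}$, and $\mathcal F_t=\sigma(\mathcal X_t,\mathbf A_t)$ ($\mathcal F_0$ trivial). Each sensor has a deterministic unknown change point $\tau_k\in\{0,1,2,\dots\}\cup\{\infty\}$; the model consists of one probability measure $P_\tau$ for each $\tau=(\tau_k)_k$. The regime of sensor $k$ at time $t$ is $l=0$ if $t\le\tau_k$ and $l=1$ if $t>\tau_k$. All statements below are for every $\tau$; densities and the functions $h_{l,k,t}$ do not depend on $\tau$. * **Assumption 1** (with conditional densities $f_{l,k,t}$ with respect to a baseline measure): for $k\in A_t$, the conditional law of $X_{k,t}$ given $(\mathcal X_{t-1},\mathbf A_t)$ has density $f_{0,k,t}(\cdot\mid\mathcal X_{t-1},\mathbf A_t)$ if $t\le\tau_k$ and $f_{1,k,t}(\cdot\mid\mathcal X_{t-1},\mathbf A_t)$ if $t>\tau_k$,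 and $\{f_{1,k,t}>0\}\subseteq\{f_{0,k,t}>0\}$. * **Assumption 2** (with constant $K<\infty$): almost surely $|A_t|\le K$ for all $t$; and for all $k,t$, $X_{k,t}$ is independent of $A_t$ conditionally on $\mathcal F_{t-1}$. The *joint form* of the second part is: for all $t$, the family $(X_{k,t})_{k}$ is independent of $A_t$ conditionally on $\mathcal F_{t-1}$. * **TIPD** (for the densities $f_{l,k,t}$): (i) $X_{k,t}$ is independent of $\mathcal F_{t-1}$ for all $k,t$; (ii) with $\tilde L_{k,t}=f_{1,k,t}(X_{k,t}\mid\mathcal X_{t-1},\mathbf A_t)/f_{0,k,t}(X_{k,t}\mid\mathcal X_{t-1},\mathbf A_t)$, almost surely for all $k\in A_t$ and all (measurable) decreasing sets $B\subseteq\mathbb R^{|A_t|}$, the function $x\mapsto P\big((\tilde L_{j,t})_{j\in A_t}\in B\mid\tilde L_{k,t}\ge x,\mathcal X_{t-1},\mathbf A_t\big)$ is nonincreasing on $[0,\infty)$ (where the conditioning event has positive conditional probability). **Models.** 1. *Independent model.* For each $t$ the $X_{k,t}\in\mathbb R^d$, $k\in\mathbb Z_+$, are mutually independent and jointly independent of $((X_{k,s})_{k},A_s)_{s<t}$;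 $X_{k,t}$ has marginal density $f_{l,k,t}$ in regime $l$; $\{f_{1,k,t}>0\}\subseteq\{f_{0,k,t}>0\}$; Assumption 2 holds. 2. *Common-factor model.* $X_{k,t}=h_{l,k,t}(Z_t)+\varepsilon_{k,t}$ in regime $l$, with $Z_t\in\mathbb R^{d_1}$ and $\varepsilon_{k,t}\in\mathbb R^{d_2}$; $(Z_t,(\varepsilon_{k,t})_k)$ is independent of $(Z_s,(\varepsilon_{k,s})_k,A_s)_{s<t}$; the families $(Z_t)_t$ and $(\varepsilon_{k,t})_{k,t}$ are independent; $Z_t$ has Lebesgue density $f_{Z_t}$ and $\varepsilon_{k,t}$ has Lebesgue density $f_{\varepsilon_{k,t}}>0$ everywhere; Assumption 2 holds. 3. *Autoregressive-type model.* $X_{k,t}=h_{l,k,t}(Y_{k,t-1})+\varepsilon_{k,t}$ in regime $l$, where $Y_{k,t-1}\in\mathbb R^{d_1}$ is $\mathcal F_{t-1}$-measurable, the families $(\varepsilon_{k,t})_k$ are independent for different $t$ and $(\varepsilon_{k,t})_k$ is independent of $\mathcal F_{t-1}$; $\varepsilon_{k,t}\in\mathbb R^{d_2}$ has Lebesgue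 density $f_{\varepsilon_{k,t}}>0$ everywhere; Assumption 2 holds. 4. *Fixed-active-set dependent model.* $A_t=\{1,\dots,K\}$ for all $t$; for $k\le K$, given $(X_{j,s})_{j\le K,s<t}$, $X_{k,t}\in\mathbb R^d$ has conditional density $f_{l,k,t}(\cdot\mid(x_{j,s})_{j\le K,s<t})$ in regime $l$; and $\{f_{1,k,t}>0\}\subseteq\{f_{0,k,t}>0\}$. **Theorem.** (a) Assumption 1 holds in model 1 with densities $f_{l,k,t}(x)$; in model 2 with densities $\int f_{\varepsilon_{k,t}}(x-h_{l,k,t}(z))f_{Z_t}(z)\,dz$; and in model 3 with densities $f_{\varepsilon_{k,t}}(x-h_{l,k,t}(Y_{k,t-1}))$. In model 4, Assumption 1 holds with the densities $f_{l,k,t}$, and Assumption 2 holds (also in its joint form). (b) TIPD holds, for the densities in (a), in the following two cases, provided that Assumption 2 holds in its joint form: * model 1 with $d=1$ where, for all $k,t$, there is a nondecreasing or nonincreasing function $\xi_{k,t}$ with $f_{1,k,t}/f_{0,k,t}=\xi_{k,t}$ on $\{f_{0,k,t}>0\}$; * model 2 with $d_2=1$ where $(X_{k,t})_{k,t}$ is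 a Gaussian random field with $E X_{k,t}=\delta_0$ for $t\le\tau_k$ and $E X_{k,t}=\delta_1$ for $t>\tau_k$, with variances that do not depend on the change points, $\mathrm{Cov}(X_{k_1,t},X_{k_2,t})\ge 0$ for all $k_1,k_2,t$, and $\mathrm{Cov}(X_{k_1,t_1},X_{k_2,t_2})=0$ whenever $t_1\ne t_2$. -/

import Mathlib

open MeasureTheory ProbabilityTheory
open scoped ENNReal

namespace SensorNetwork

noncomputable section

/-- A change point model on a reconfigurable sensor network.  Sensors and times are positive
integers and observations take values in `E`.  `X k t` is the observation of sensor `k` at time `t`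
and `A t` is the set of sensors that are active at time `t`.  The deterministic change points are
unknown: the model gives one probability measure `P τ` for every configuration
`τ : sensor ↦ change point` with change points in `{0, 1, 2, …} ∪ {∞}`. -/
structure Model (Ω E : Type*) [MeasurableSpace Ω] [MeasurableSpace E] where
  P : (ℕ+ → ℕ∞) → Measure Ω
  isProb : ∀ τ, IsProbabilityMeasure (P τ)
  X : ℕ+ → ℕ+ → Ω → E
  A : ℕ+ → Ω → Set ℕ+
  measurable_X : ∀ k t, Measurable (X k t)
  measurable_A : ∀ t, Measurable (A t)

attribute [instance] Model.isProb

/-- The regime at time `t` of a sensor with change point `c`: `0` (pre-change) if `t ≤ c`, and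
`1` (post-change) if `t > c`. -/
def regime (c : ℕ∞) (t : ℕ+) : Fin 2 := if ((t : ℕ) : ℕ∞) ≤ c then 0 else 1

/-- Values of (observed data before time `t`, active sets before time `t`).  Entries of the data
array at inactive positions are set to `0`; as the active sets are part of the value, it carries
exactly the information of the array of observed data together with the active sets. -/
abbrev PastVal (E : Type*) (t : ℕ+) : Type _ :=
  (Set.Iio t → ℕ+ → E) × (Set.Iio t → Set ℕ+)

/-- Values of (observed data before time `t`, active sets up to and including time `t`). -/
abbrev HistVal (E : Type*) (t : ℕ+) : Type _ :=
  (Set.Iio t → ℕ+ → E) × (Set.Iic t → Set ℕ+)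

/-- The conditional independence of the random elements `U` and `V` given the σ-algebra `m`:
`μ(U ∈ S, V ∈ T | m) = μ(U ∈ S | m) μ(V ∈ T | m)` almost surely for all measurable `S`, `T`.
(Mathlib's `CondIndepFun` is the same notion, restricted to standard Borel `Ω`.) -/
def CondIndepGiven {Ω α β : Type*} [MeasurableSpace Ω] [MeasurableSpace α] [MeasurableSpace β]
    (μ : Measure Ω) (m : MeasurableSpace Ω) (U : Ω → α) (V : Ω → β) : Prop :=
  ∀ (S : Set α) (T : Set β), MeasurableSet S → MeasurableSet T →
    μ⟦U ⁻¹' S ∩ V ⁻¹' T | m⟧ =ᵐ[μ] μ⟦U ⁻¹' S | m⟧ * μ⟦V ⁻¹' T | m⟧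

namespace Model

variable {Ω E : Type*} [MeasurableSpace Ω] [MeasurableSpace E]

open Classical in
/-- Observed data before time `t`: the value of sensor `k` at time `s < t` is recorded if and only
if `k` is active at time `s`. -/
def observed [Zero E] (M : Model Ω E) (t : ℕ+) (ω : Ω) : Set.Iio t → ℕ+ → E :=
  fun s k => if k ∈ M.A s ω then M.X k s ω else 0

/-- Observed data and active sets before time `t`. -/
def past [Zero E] (M : Model Ω E) (t : ℕ+) (ω : Ω) : PastVal E t :=
  (M.observed t ω, fun s => M.A s ω)

/-- Observed data before time `t` and active sets up to and including time `t`. -/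
def history [Zero E] (M : Model Ω E) (t : ℕ+) (ω : Ω) : HistVal E t :=
  (M.observed t ω, fun s => M.A s ω)

/-- The information σ-algebra `𝓕_{t-1}`, generated by all observed data and active sets before
time `t`; it is trivial for `t = 1`. -/
abbrev pastSigma [Zero E] (M : Model Ω E) (t : ℕ+) : MeasurableSpace Ω :=
  MeasurableSpace.comap (M.past t) inferInstance

/-- The change point density assumption, with baseline measure `ν` and given conditional densities
`f l k t h x` (`l = 0` pre-change, `l = 1` post-change; `h` a value of the history): for all change
points `τ`, for each time `t` and each sensor `k` active at time `t`, the conditional distribution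
of `X k t` given the observed data before `t` and the active sets up to `t` has density `f 0 k t`
if `t ≤ τ k` and `f 1 k t` if `t > τ k`; and the support of `f 1 k t` is contained in that of
`f 0 k t`.  The densities do not depend on the change points. -/
structure HasChangeDensities [Zero E] [StandardBorelSpace E] [Nonempty E] (M : Model Ω E)
    (ν : Measure E) (f : Fin 2 → ℕ+ → (t : ℕ+) → HistVal E t → E → ℝ≥0∞) : Prop where
  measurable_density : ∀ l k t, Measurable (fun p : HistVal E t × E => f l k t p.1 p.2)
  lintegral_density : ∀ l k t h, ∫⁻ x, f l k t h x ∂ν = 1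
  support_subset : ∀ k t h, {x | 0 < f 1 k t h x} ⊆ {x | 0 < f 0 k t h x}
  conditional_law : ∀ τ k t, ∀ᵐ ω ∂(M.P τ), k ∈ M.A t ω →
    condDistrib (M.X k t) (M.history t) (M.P τ) (M.history t ω)
      = ν.withDensity (f (regime (τ k) t) k t (M.history t ω))

/-- The assumption on the active sets: almost surely at most `K` sensors are active at any time,
and, for all `k` and `t`, `X k t` is independent of `A t` conditional on `𝓕_{t-1}`. -/
structure ActiveSetAssumption [Zero E] (M : Model Ω E) (K : ℕ) : Prop where
  bounded : ∀ τ, ∀ᵐ ω ∂(M.P τ), ∀ t, (M.A t ω).encard ≤ K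
  condIndep : ∀ τ k t, CondIndepGiven (M.P τ) (M.pastSigma t) (M.X k t) (M.A t)

/-- The selection of the active sets does not rely on the current observations, taken jointly over
all sensors: for all `t`, the family `(X k t)_k` is independent of `A t` conditional on
`𝓕_{t-1}`. -/
def JointSelection [Zero E] (M : Model Ω E) : Prop :=
  ∀ τ t, CondIndepGiven (M.P τ) (M.pastSigma t) (fun ω k => M.X k t ω) (M.A t)

/-- The likelihood ratio of sensor `k` at time `t`. -/
def likelihoodRatio [Zero E] (M : Model Ω E)
    (f : Fin 2 → ℕ+ → (t : ℕ+) → HistVal E t → E → ℝ≥0∞) (t : ℕ+) (ω : Ω) (k : ℕ+) : ℝ :=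
  (f 1 k t (M.history t ω) (M.X k t ω) / f 0 k t (M.history t ω) (M.X k t ω)).toReal

/-- The regular conditional distribution of the likelihood ratios at time `t`, given the observed
data before `t` and the active sets up to `t`. -/
def likelihoodRatioLaw [Zero E] (M : Model Ω E)
    (f : Fin 2 → ℕ+ → (t : ℕ+) → HistVal E t → E → ℝ≥0∞) (τ : ℕ+ → ℕ∞) (t : ℕ+) (ω : Ω) :
    Measure (ℕ+ → ℝ) :=
  condDistrib (M.likelihoodRatio f t) (M.history t) (M.P τ) (M.history t ω)

/-- Time independent positive dependence.  Almost surely, if `a` is the active set at time `t`,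
then for all `k ∈ a` and all decreasing measurable sets `B ⊆ ℝ^a` the function
`x ↦ P((L_j)_{j ∈ a} ∈ B | L_k ≥ x, history)` is nonincreasing on `[0, ∞)` (where the conditioning
event `{L_k ≥ x}` has positive conditional probability). -/
structure TIPD [Zero E] (M : Model Ω E)
    (f : Fin 2 → ℕ+ → (t : ℕ+) → HistVal E t → E → ℝ≥0∞) : Prop where
  time_independence : ∀ τ k t, IndepFun (M.X k t) (M.past t) (M.P τ)
  positive_dependence : ∀ τ t, ∀ᵐ ω ∂(M.P τ), ∀ a : Finset ℕ+, M.A t ω = ↑a → ∀ k ∈ a,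
    ∀ B : Set (a → ℝ), MeasurableSet B → IsLowerSet B →
      AntitoneOn
        (fun x : ℝ => (M.likelihoodRatioLaw f τ t ω)[{v | (fun j : a => v j) ∈ B} | {v | x ≤ v k}])
        {x : ℝ | 0 ≤ x ∧ M.likelihoodRatioLaw f τ t ω {v | x ≤ v k} ≠ 0}

/-! ### The independent model -/

/-- Observations independent across sensors and time, and of the past active sets; `X k t` has the
marginal density `f 0 k t` before and `f 1 k t` after the change. -/
structure IsIndependentModel [Zero E] (M : Model Ω E) (K : ℕ) (ν : Measure E)
    (f : Fin 2 → ℕ+ → ℕ+ → E → ℝ≥0∞) : Prop where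
  indep_sensors : ∀ τ t, iIndepFun (fun k => M.X k t) (M.P τ)
  indep_past : ∀ τ t, IndepFun (fun ω k => M.X k t ω)
    (fun ω => ((fun s k => M.X k s ω, fun s => M.A s ω) : PastVal E t)) (M.P τ)
  measurable_density : ∀ l k t, Measurable (f l k t)
  marginal_law : ∀ τ k t, (M.P τ).map (M.X k t) = ν.withDensity (f (regime (τ k) t) k t)
  support_subset : ∀ k t, {x | 0 < f 1 k t x} ⊆ {x | 0 < f 0 k t x}
  active : M.ActiveSetAssumption K

/-! ### The common factor model -/

/-- `X k t = h_l(Z_t) + ε_{k,t}` with a common factor `Z_t` and noises `ε_{k,t}`, where `l` is the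
regime.  The pair (factor, noises) at time `t` is independent of the factors, noises and active sets
before `t`, while the noises at a fixed time may be arbitrarily dependent across sensors. -/
structure IsCommonFactorModel [NormedAddCommGroup E] [InnerProductSpace ℝ E]
    [FiniteDimensional ℝ E] [BorelSpace E] {d₁ : ℕ} (M : Model Ω E) (K : ℕ)
    (Z : ℕ+ → Ω → EuclideanSpace ℝ (Fin d₁)) (ε : ℕ+ → ℕ+ → Ω → E)
    (h : Fin 2 → ℕ+ → ℕ+ → EuclideanSpace ℝ (Fin d₁) → E)
    (fZ : ℕ+ → EuclideanSpace ℝ (Fin d₁) → ℝ≥0∞) (fε : ℕ+ → ℕ+ → E → ℝ≥0∞) : Prop where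
  measurable_Z : ∀ t, Measurable (Z t)
  measurable_ε : ∀ k t, Measurable (ε k t)
  measurable_h : ∀ l k t, Measurable (h l k t)
  measurable_fZ : ∀ t, Measurable (fZ t)
  measurable_fε : ∀ k t, Measurable (fε k t)
  indep_past : ∀ τ t, IndepFun (fun ω => (Z t ω, fun k => ε k t ω))
    (fun ω => (fun s : Set.Iio t => (Z s ω, fun k => ε k s ω, M.A s ω))) (M.P τ)
  indep_factor_noise : ∀ τ, IndepFun (fun ω t => Z t ω) (fun ω k t => ε k t ω) (M.P τ)
  observation : ∀ τ k t, ∀ᵐ ω ∂(M.P τ), M.X k t ω = h (regime (τ k) t) k t (Z t ω) + ε k t ω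
  factor_law : ∀ τ t, (M.P τ).map (Z t) = volume.withDensity (fZ t)
  noise_law : ∀ τ k t, (M.P τ).map (ε k t) = volume.withDensity (fε k t)
  noise_support : ∀ k t e, 0 < fε k t e
  active : M.ActiveSetAssumption K

/-- The density of `h_l(Z_t) + ε_{k,t}`. -/
def factorDensity [NormedAddCommGroup E] {d₁ : ℕ}
    (h : Fin 2 → ℕ+ → ℕ+ → EuclideanSpace ℝ (Fin d₁) → E)
    (fZ : ℕ+ → EuclideanSpace ℝ (Fin d₁) → ℝ≥0∞) (fε : ℕ+ → ℕ+ → E → ℝ≥0∞)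
    (l : Fin 2) (k t : ℕ+) (x : E) : ℝ≥0∞ :=
  ∫⁻ z, fε k t (x - h l k t z) * fZ t z

/-- The observations are a Gaussian random field with mean `δ 0` before and `δ 1` after the change;
the change affects the means only, so the variances do not depend on the change points; covariances
are nonnegative within each time and vanish across different times. -/
structure IsPositiveGaussianField (M : Model Ω ℝ) (δ : Fin 2 → ℝ) : Prop where
  gaussian : ∀ τ, IsGaussianProcess (fun p : ℕ+ × ℕ+ => M.X p.1 p.2) (M.P τ)
  mean : ∀ τ k t, ∫ ω, M.X k t ω ∂(M.P τ) = δ (regime (τ k) t)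
  variance_eq : ∀ τ τ' k t, Var[M.X k t; M.P τ] = Var[M.X k t; M.P τ']
  cov_nonneg : ∀ τ k₁ k₂ t, 0 ≤ cov[M.X k₁ t, M.X k₂ t; M.P τ]
  cov_eq_zero : ∀ τ k₁ k₂ t₁ t₂, t₁ ≠ t₂ → cov[M.X k₁ t₁, M.X k₂ t₂; M.P τ] = 0

/-! ### The autoregressive type model -/

/-- `X k t = h_l(Y_{k,t-1}) + ε_{k,t}` with `Y_{k,t-1}` an `𝓕_{t-1}`-measurable random vector
(written `Y k t` here), where `l` is the regime.  The noises are independent across time, and those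
at time `t` are independent of `𝓕_{t-1}`; they may be arbitrarily dependent across sensors. -/
structure IsAutoregressiveModel [NormedAddCommGroup E] [InnerProductSpace ℝ E]
    [FiniteDimensional ℝ E] [BorelSpace E] {d₁ : ℕ} (M : Model Ω E) (K : ℕ)
    (Y : ℕ+ → ℕ+ → Ω → EuclideanSpace ℝ (Fin d₁)) (ε : ℕ+ → ℕ+ → Ω → E)
    (h : Fin 2 → ℕ+ → ℕ+ → EuclideanSpace ℝ (Fin d₁) → E) (fε : ℕ+ → ℕ+ → E → ℝ≥0∞) : Prop where
  measurable_Y : ∀ k t, Measurable[M.pastSigma t] (Y k t)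
  measurable_ε : ∀ k t, Measurable (ε k t)
  measurable_h : ∀ l k t, Measurable (h l k t)
  measurable_fε : ∀ k t, Measurable (fε k t)
  indep_time : ∀ τ, iIndepFun (fun t ω k => ε k t ω) (M.P τ)
  indep_past : ∀ τ t, IndepFun (fun ω k => ε k t ω) (M.past t) (M.P τ)
  observation : ∀ τ k t, ∀ᵐ ω ∂(M.P τ), M.X k t ω = h (regime (τ k) t) k t (Y k t ω) + ε k t ω
  noise_law : ∀ τ k t, (M.P τ).map (ε k t) = volume.withDensity (fε k t)
  noise_support : ∀ k t e, 0 < fε k t e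
  active : M.ActiveSetAssumption K

/-! ### The dependent model with a fixed active set -/

/-- Arrays of data of the sensors `1, …, K` before time `t`. -/
abbrev FixedVal (E : Type*) (K : ℕ) (t : ℕ+) : Type _ :=
  Set.Iio t → {k : ℕ+ // (k : ℕ) ≤ K} → E

/-- The sensors `1, …, K` are active at all times, and, for each of these sensors, `X k t` has the
conditional density `f 0 k t` before and `f 1 k t` after the change, given the data of the sensors
`1, …, K` before time `t`. -/
structure IsFixedActiveSetModel [StandardBorelSpace E] [Nonempty E] (M : Model Ω E)
    (K : ℕ) (ν : Measure E)
    (f : Fin 2 → ℕ+ → (t : ℕ+) → FixedVal E K t → E → ℝ≥0∞) : Prop where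
  active_eq : ∀ τ, ∀ᵐ ω ∂(M.P τ), ∀ t, M.A t ω = {k : ℕ+ | (k : ℕ) ≤ K}
  measurable_density : ∀ l k t, Measurable (fun p : FixedVal E K t × E => f l k t p.1 p.2)
  lintegral_density : ∀ l k t y, ∫⁻ x, f l k t y x ∂ν = 1
  support_subset : ∀ k t y, {x | 0 < f 1 k t y x} ⊆ {x | 0 < f 0 k t y x}
  conditional_law : ∀ τ (k t : ℕ+), (k : ℕ) ≤ K → ∀ᵐ ω ∂(M.P τ),
    condDistrib (M.X k t) (fun ω => ((fun s j => M.X j s ω) : FixedVal E K t)) (M.P τ)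
        (fun s j => M.X j s ω)
      = ν.withDensity (f (regime (τ k) t) k t (fun s j => M.X j s ω))

end Model

end

end SensorNetwork

/-!
The four models reduce to one fact about regular conditional distributions. If `X` has conditional
law `κ (U)` given `U`, and `X` is conditionally independent of `V` given `U`, then `X` also has
conditional law `κ (U)` given `(U, V)` (`map_prodMk_eq_compProd_of_condIndepGiven`). With `U` the
past and `V` the current active set, it suffices to find the law of `X k t` given the past
(`Model.map_history_eq_compProd`). In the independent and common factor models `X k t` is
independent of the past, and its law is given, respectively computed by Tonelli's theorem. In the
autoregressive model the law given the past is that of the noise shifted by `h (Y k t)`, where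
`Y k t` is a function of the past by the Doob–Dynkin lemma. In the fixed active set model the active
sets are almost surely constant, hence conditionally independent of everything, and the history is
almost surely a function of the data array and conversely.

For positive dependence, the observations at time `t` are jointly independent of the history, so the
conditional law of the likelihood ratios is their unconditional law. It then remains to write the
vector of likelihood ratios as `G (T, W)`, with `G` nondecreasing in the real variable `T`, with `W`
independent of `T`, and with the `k`-th ratio a nondecreasing function of `T` alone: conditioning
`T` to lie in a smaller upper set moves its mass to places where the decreasing event has smaller
conditional probability (`cond_preimage_le_cond_preimage`, `antitoneOn_cond_of_monotone_driver`).
In the independent model `T` is the `k`-th ratio and `W` the vector of the other ones. In the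
Gaussian model the `j`-th ratio is `exp` of an affine function of `X j t` with slope
`(δ 1 - δ 0) / Var (X j t)`; one takes `T = (δ 1 - δ 0) * X k t` and, for `W`, the residuals of the
regressions on `X k t`, which are independent of `X k t`; the regression coefficients are
nonnegative by the assumption on the covariances.
-/

namespace SensorNetwork

/-! ### Conditional laws as disintegrations -/

/-- Adding to the conditioning variable `U` a random element `V` that is conditionally independent
of `X` given `U` does not change the conditional law `κ` of `X`. -/
lemma map_prodMk_eq_compProd_of_condIndepGiven {Ω α β E : Type*} [MeasurableSpace Ω]
    [MeasurableSpace α] [MeasurableSpace β] [MeasurableSpace E] [StandardBorelSpace E] [Nonempty E]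
    {μ : Measure Ω} [IsProbabilityMeasure μ] {U : Ω → α} {V : Ω → β} {X : Ω → E}
    (hU : Measurable U) (hV : Measurable V) (hX : Measurable X)
    {κ : Kernel α E} [IsMarkovKernel κ]
    (hκ : μ.map (fun ω => (U ω, X ω)) = μ.map U ⊗ₘ κ)
    (hUV : CondIndepGiven μ (MeasurableSpace.comap U inferInstance) X V) :
    μ.map (fun ω => ((U ω, V ω), X ω))
      = μ.map (fun ω => (U ω, V ω)) ⊗ₘ κ.comap Prod.fst measurable_fst := by
  have : IsProbabilityMeasure (μ.map (fun ω => ((U ω, V ω), X ω))) :=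
    Measure.isProbabilityMeasure_map (by fun_prop)
  rw [Measure.ext_prod₃_iff']
  intro s t u hs ht hu
  have hm := hU.comap_le
  have hs' : MeasurableSet[MeasurableSpace.comap U inferInstance] (U ⁻¹' s) := ⟨s, hs, rfl⟩
  set g : Ω → ℝ := fun ω => (κ (U ω)).real u with hg
  have hgm : StronglyMeasurable[MeasurableSpace.comap U inferInstance] g := by
    refine Measurable.stronglyMeasurable ?_
    exact ((κ.measurable_coe hu).comp (comap_measurable U)).ennreal_toReal
  have hgi : Integrable g μ := by
    refine Integrable.of_bound (hgm.mono hm).aestronglyMeasurable 1 (.of_forall fun ω => ?_)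
    rw [Real.norm_of_nonneg measureReal_nonneg]
    exact measureReal_le_one
  have hXu : g =ᵐ[μ] μ⟦X ⁻¹' u | MeasurableSpace.comap U inferInstance⟧ := by
    refine Filter.EventuallyEq.trans ?_ (condDistrib_ae_eq_condExp hU hX hu)
    filter_upwards [ae_of_ae_map hU.aemeasurable
      (condDistrib_ae_eq_of_measure_eq_compProd U hX.aemeasurable hκ)] with ω hω
    rw [hg, hω]
  have hVt : Integrable ((V ⁻¹' t).indicator fun _ => (1 : ℝ)) μ :=
    (integrable_const _).indicator (hV ht)
  have hgV : g * (V ⁻¹' t).indicator (fun _ => (1 : ℝ)) = (V ⁻¹' t).indicator g := by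
    ext ω; by_cases h : ω ∈ V ⁻¹' t <;> simp [h]
  -- integrate the factorised conditional probability over `U ∈ s` and pull `g` out of `μ[· | U]`
  have key : μ.real (U ⁻¹' s ∩ (X ⁻¹' u ∩ V ⁻¹' t)) = ∫ ω in U ⁻¹' s ∩ V ⁻¹' t, g ω ∂μ := by
    calc μ.real (U ⁻¹' s ∩ (X ⁻¹' u ∩ V ⁻¹' t))
        = ∫ ω in U ⁻¹' s, (X ⁻¹' u ∩ V ⁻¹' t).indicator (fun _ => (1 : ℝ)) ω ∂μ := by
          rw [setIntegral_indicator ((hX hu).inter (hV ht))]; simp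
      _ = ∫ ω in U ⁻¹' s, (μ⟦X ⁻¹' u ∩ V ⁻¹' t | MeasurableSpace.comap U inferInstance⟧) ω ∂μ :=
          (setIntegral_condExp hm ((integrable_const _).indicator ((hX hu).inter (hV ht))) hs').symm
      _ = ∫ ω in U ⁻¹' s, (μ[g * (V ⁻¹' t).indicator (fun _ => (1 : ℝ)) |
            MeasurableSpace.comap U inferInstance]) ω ∂μ := by
          refine integral_congr_ae (ae_restrict_of_ae ?_)
          filter_upwards [hUV u t hu ht, hXu, condExp_mul_of_stronglyMeasurable_left hgm
            (hgV ▸ hgi.indicator (hV ht)) hVt] with ω h1 h2 h3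
          rw [h1, h3, Pi.mul_apply, Pi.mul_apply, h2]
      _ = ∫ ω in U ⁻¹' s, (V ⁻¹' t).indicator g ω ∂μ := by
          rw [setIntegral_condExp hm (hgV ▸ hgi.indicator (hV ht)) hs', hgV]
      _ = _ := setIntegral_indicator (hV ht)
  rw [Measure.map_apply (by fun_prop) ((hs.prod ht).prod hu),
    Measure.compProd_apply_prod (hs.prod ht) hu,
    setLIntegral_map (hs.prod ht) (Kernel.measurable_coe _ hu) (by fun_prop)]
  have h1 : (fun ω => ((U ω, V ω), X ω)) ⁻¹' ((s ×ˢ t) ×ˢ u) = U ⁻¹' s ∩ (X ⁻¹' u ∩ V ⁻¹' t) := by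
    ext ω; simp only [Set.mem_preimage, Set.mem_prod, Set.mem_inter_iff]; tauto
  have h2 : (fun ω => (U ω, V ω)) ⁻¹' (s ×ˢ t) = U ⁻¹' s ∩ V ⁻¹' t := rfl
  rw [h1, h2, ← ofReal_measureReal, key, ofReal_integral_eq_lintegral_ofReal hgi.integrableOn
    (.of_forall fun ω => measureReal_nonneg)]
  refine lintegral_congr fun ω => ?_
  simp [hg]

/-- A conditional law given `G` is also one given `H` if almost surely `G` and `H` are measurable
functions of each other. -/
lemma map_prodMk_eq_compProd_of_ae_eq {Ω α β E : Type*} [MeasurableSpace Ω]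
    [MeasurableSpace α] [MeasurableSpace β] [MeasurableSpace E]
    {μ : Measure Ω} [IsProbabilityMeasure μ] {G : Ω → α} {H : Ω → β} {X : Ω → E}
    (hG : Measurable G) (hH : Measurable H) (hX : Measurable X)
    {e : α → β} {d : β → α} (he : Measurable e) (hd : Measurable d)
    (heG : H =ᵐ[μ] e ∘ G) (hdH : G =ᵐ[μ] d ∘ H) {κ : Kernel α E} [IsMarkovKernel κ]
    (hκ : μ.map (fun ω => (G ω, X ω)) = μ.map G ⊗ₘ κ) :
    μ.map (fun ω => (H ω, X ω)) = μ.map H ⊗ₘ κ.comap d hd := by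
  have : IsProbabilityMeasure (μ.map (fun ω => (H ω, X ω))) :=
    Measure.isProbabilityMeasure_map (by fun_prop)
  rw [Measure.ext_prod_iff]
  intro s u hs hu
  rw [Measure.map_apply (by fun_prop) (hs.prod hu), Measure.compProd_apply_prod hs hu,
    setLIntegral_map hs (Kernel.measurable_coe _ hu) (by fun_prop)]
  have h := congrArg (fun ρ => ρ ((e ⁻¹' s) ×ˢ u)) hκ
  rw [Measure.map_apply (by fun_prop) ((he hs).prod hu), Measure.compProd_apply_prod (he hs) hu,
    setLIntegral_map (he hs) (Kernel.measurable_coe _ hu) (by fun_prop)] at h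
  have hset : H ⁻¹' s =ᵐ[μ] G ⁻¹' (e ⁻¹' s) := by
    filter_upwards [heG] with ω hω
    simp only [Set.preimage, Set.mem_ofPred_eq, Function.comp_apply] at hω ⊢
    change (_ ∈ s) = (_ ∈ s)
    rw [hω]
  calc μ ((fun ω => (H ω, X ω)) ⁻¹' s ×ˢ u)
      = μ ((fun ω => (G ω, X ω)) ⁻¹' (e ⁻¹' s) ×ˢ u) := by
        refine measure_congr ?_
        change (H ⁻¹' s ∩ X ⁻¹' u : Set Ω) =ᵐ[μ] (G ⁻¹' (e ⁻¹' s) ∩ X ⁻¹' u : Set Ω)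
        exact hset.inter (ae_eq_refl _)
    _ = ∫⁻ ω in H ⁻¹' s, κ (G ω) u ∂μ := by rw [h, setLIntegral_congr hset]
    _ = _ := by
        refine lintegral_congr_ae (ae_restrict_of_ae ?_)
        filter_upwards [hdH] with ω hω
        rw [hω]; rfl

/-! ### Random vectors shifted by an independent noise -/

section Shift

variable {Ω α E : Type*} [MeasurableSpace Ω] [MeasurableSpace α]
  [NormedAddCommGroup E] [InnerProductSpace ℝ E] [FiniteDimensional ℝ E] [MeasurableSpace E]
  [BorelSpace E]

/-- The conditional law of `X = c(U) + ε`, with `ε` independent of `U` and of density `f`, has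
density `x ↦ f (x - c u)` given `U = u`. -/
lemma map_prodMk_eq_compProd_of_shift {μ : Measure Ω} [IsProbabilityMeasure μ] {U : Ω → α}
    {ε X : Ω → E} (hU : Measurable U) (hε : Measurable ε)
    (hind : IndepFun ε U μ) {c : α → E} (hc : Measurable c)
    (hXc : ∀ᵐ ω ∂μ, X ω = c (U ω) + ε ω) {f : E → ℝ≥0∞}
    (hlaw : μ.map ε = volume.withDensity f) {κ : Kernel α E} [IsMarkovKernel κ]
    (hκ : ∀ u, κ u = volume.withDensity (fun x => f (x - c u))) :
    μ.map (fun ω => (U ω, X ω)) = μ.map U ⊗ₘ κ := by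
  have : IsProbabilityMeasure (μ.map ε) := Measure.isProbabilityMeasure_map hε.aemeasurable
  have : IsProbabilityMeasure (μ.map U) := Measure.isProbabilityMeasure_map hU.aemeasurable
  have h1 : μ.map (fun ω => (U ω, X ω))
      = (μ.map (fun ω => (U ω, ε ω))).map (fun p => (p.1, c p.1 + p.2)) := by
    rw [Measure.map_map (by fun_prop) (by fun_prop)]
    refine Measure.map_congr ?_
    filter_upwards [hXc] with ω hω
    simp [hω]
  rw [h1, (indepFun_iff_map_prod_eq_prod_map_map hU.aemeasurable hε.aemeasurable).1 hind.symm]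
  ext s hs
  have hs' : MeasurableSet ((fun p : α × E => (p.1, c p.1 + p.2)) ⁻¹' s) :=
    (by fun_prop : Measurable fun p : α × E => (p.1, c p.1 + p.2)) hs
  rw [Measure.map_apply (by fun_prop) hs, Measure.prod_apply hs', Measure.compProd_apply hs]
  refine lintegral_congr fun u => ?_
  have hu : MeasurableSet (Prod.mk u ⁻¹' s) := measurable_prodMk_left hs
  rw [hκ, hlaw, withDensity_apply _ hu, withDensity_apply _ (measurable_prodMk_left hs'),
    ← lintegral_indicator hu, ← lintegral_indicator (measurable_prodMk_left hs'),
    ← lintegral_sub_right_eq_self _ (c u)]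
  refine lintegral_congr fun x => ?_
  have hx : x - c u ∈ Prod.mk u ⁻¹' ((fun p : α × E => (p.1, c p.1 + p.2)) ⁻¹' s) ↔
      x ∈ Prod.mk u ⁻¹' s := by
    change (u, c u + (x - c u)) ∈ s ↔ (u, x) ∈ s
    rw [add_sub_cancel]
  by_cases h : x ∈ Prod.mk u ⁻¹' s
  · rw [Set.indicator_of_mem (hx.2 h), Set.indicator_of_mem h]
  · rw [Set.indicator_of_notMem (mt hx.1 h), Set.indicator_of_notMem h]

lemma lintegral_shift_eq_one {μ : Measure Ω} [IsProbabilityMeasure μ] {ε : Ω → E}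
    (hε : Measurable ε) {f : E → ℝ≥0∞} (hlaw : μ.map ε = volume.withDensity f) (c : E) :
    ∫⁻ x, f (x - c) = 1 := by
  have : IsProbabilityMeasure (μ.map ε) := Measure.isProbabilityMeasure_map hε.aemeasurable
  rw [lintegral_sub_right_eq_self (fun x => f x) c, ← setLIntegral_univ,
    ← withDensity_apply _ .univ, ← hlaw, measure_univ]

end Shift

/-- The Markov kernel with density `f a` with respect to `ν` at `a`. -/
noncomputable def densityKernel {α E : Type*} [MeasurableSpace α] [MeasurableSpace E]
    (ν : Measure E) [SFinite ν] (f : α → E → ℝ≥0∞) : Kernel α E :=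
  (Kernel.const α ν).withDensity f

lemma densityKernel_apply {α E : Type*} [MeasurableSpace α] [MeasurableSpace E]
    {ν : Measure E} [SFinite ν] {f : α → E → ℝ≥0∞} (hf : Measurable (Function.uncurry f)) (a : α) :
    densityKernel ν f a = ν.withDensity (f a) := by
  rw [densityKernel, Kernel.withDensity_apply _ hf, Kernel.const_apply]

lemma isMarkovKernel_densityKernel {α E : Type*} [MeasurableSpace α] [MeasurableSpace E]
    {ν : Measure E} [SFinite ν] {f : α → E → ℝ≥0∞} (hf : Measurable (Function.uncurry f))
    (h1 : ∀ a, ∫⁻ x, f a x ∂ν = 1) : IsMarkovKernel (densityKernel ν f) where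
  isProbabilityMeasure a := ⟨by
    rw [densityKernel_apply hf, withDensity_apply _ .univ, setLIntegral_univ, h1]⟩

/-! ### The history of the network -/

namespace Model

section History

variable {Ω E : Type*} [MeasurableSpace Ω] [MeasurableSpace E]

lemma measurableSet_mem_of_measurable {f : Ω → Set ℕ+} (hf : Measurable f) (k : ℕ+) :
    MeasurableSet {ω | k ∈ f ω} :=
  measurableSet_setOfPred.2 (measurable_set_iff.1 hf k)

/-- Recovers the data and active sets before time `t` from the history. -/
def pastOfHist {t : ℕ+} (y : HistVal E t) : PastVal E t :=
  (y.1, fun s => y.2 ⟨s, Set.Iio_subset_Iic_self s.2⟩)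

lemma measurable_pastOfHist {t : ℕ+} : Measurable (pastOfHist : HistVal E t → PastVal E t) := by
  unfold pastOfHist; fun_prop

/-- Appends the active set at time `t` to the data and active sets before time `t`. -/
noncomputable def histOfPast {t : ℕ+} (p : PastVal E t × Set ℕ+) : HistVal E t :=
  (p.1.1, fun s => if h : (s : ℕ+) < t then p.1.2 ⟨s, h⟩ else p.2)

lemma measurable_histOfPast {t : ℕ+} :
    Measurable (histOfPast : PastVal E t × Set ℕ+ → HistVal E t) := by
  refine Measurable.prodMk (by fun_prop) (measurable_pi_lambda _ fun s => ?_)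
  by_cases h : (s : ℕ+) < t
  · simp only [h, dite_true]; fun_prop
  · simp only [h, dite_false]; fun_prop

variable [Zero E] (M : Model Ω E)

lemma measurable_observed (t : ℕ+) : Measurable (M.observed t) := by
  classical
  refine measurable_pi_lambda _ fun s => measurable_pi_lambda _ fun k => ?_
  exact Measurable.ite (measurableSet_mem_of_measurable (M.measurable_A s) k) (M.measurable_X k s)
    measurable_const

lemma measurable_past (t : ℕ+) : Measurable (M.past t) :=
  (M.measurable_observed t).prodMk (measurable_pi_lambda _ fun s => M.measurable_A s)

lemma measurable_history (t : ℕ+) : Measurable (M.history t) :=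
  (M.measurable_observed t).prodMk (measurable_pi_lambda _ fun s => M.measurable_A s)

lemma pastOfHist_history (t : ℕ+) (ω : Ω) : pastOfHist (M.history t ω) = M.past t ω := rfl

lemma histOfPast_past (t : ℕ+) (ω : Ω) : histOfPast (M.past t ω, M.A t ω) = M.history t ω := by
  refine Prod.ext rfl (funext fun s => ?_)
  by_cases h : (s : ℕ+) < t
  · simp [histOfPast, past, history, h]
  · have : (s : ℕ+) = t := le_antisymm s.2 (not_lt.1 h)
    simp [histOfPast, history, this]

/-- Under conditionally independent selection of the active set, the conditional law of the
observations given the past is also their conditional law given the history, which includes the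
current active set. -/
lemma map_history_eq_compProd {F : Type*} [MeasurableSpace F] [StandardBorelSpace F] [Nonempty F]
    {τ : ℕ+ → ℕ∞} {t : ℕ+} {W : Ω → F} (hW : Measurable W) {κ : Kernel (PastVal E t) F}
    [IsMarkovKernel κ]
    (hκ : (M.P τ).map (fun ω => (M.past t ω, W ω)) = ((M.P τ).map (M.past t)) ⊗ₘ κ)
    (hA : CondIndepGiven (M.P τ) (M.pastSigma t) W (M.A t)) :
    (M.P τ).map (fun ω => (M.history t ω, W ω))
      = ((M.P τ).map (M.history t)) ⊗ₘ κ.comap pastOfHist measurable_pastOfHist := by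
  have h := map_prodMk_eq_compProd_of_condIndepGiven (M.measurable_past t) (M.measurable_A t) hW
    hκ hA
  exact map_prodMk_eq_compProd_of_ae_eq ((M.measurable_past t).prodMk (M.measurable_A t))
    (M.measurable_history t) hW measurable_histOfPast
    (d := fun y => (pastOfHist y, y.2 ⟨t, Set.self_mem_Iic⟩))
    (measurable_pastOfHist.prodMk ((measurable_pi_apply _).comp measurable_snd))
    (.of_forall fun ω => (M.histOfPast_past t ω).symm) (.of_forall fun ω => rfl) h

lemma map_history_eq_compProd_const {F : Type*} [MeasurableSpace F] [StandardBorelSpace F]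
    [Nonempty F] {τ : ℕ+ → ℕ∞} {t : ℕ+} {W : Ω → F} (hW : Measurable W) (hWp : IndepFun W (M.past t) (M.P τ))
    (hA : CondIndepGiven (M.P τ) (M.pastSigma t) W (M.A t)) :
    (M.P τ).map (fun ω => (M.history t ω, W ω))
      = ((M.P τ).map (M.history t)) ⊗ₘ Kernel.const _ ((M.P τ).map W) := by
  have := Measure.isProbabilityMeasure_map (μ := M.P τ) hW.aemeasurable
  refine M.map_history_eq_compProd hW (κ := Kernel.const _ ((M.P τ).map W)) ?_ hA
  rw [Measure.compProd_const]
  exact (indepFun_iff_map_prod_eq_prod_map_map (M.measurable_past t).aemeasurable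
    hW.aemeasurable).1 hWp.symm

lemma condDistrib_history_ae_eq {F : Type*} [MeasurableSpace F] [StandardBorelSpace F] [Nonempty F]
    {τ : ℕ+ → ℕ∞} {t : ℕ+} {W : Ω → F} (hW : Measurable W) {κ : Kernel (HistVal E t) F}
    [IsMarkovKernel κ]
    (hκ : (M.P τ).map (fun ω => (M.history t ω, W ω)) = ((M.P τ).map (M.history t)) ⊗ₘ κ) :
    ∀ᵐ ω ∂(M.P τ), condDistrib W (M.history t) (M.P τ) (M.history t ω) = κ (M.history t ω) :=
  ae_of_ae_map (M.measurable_history t).aemeasurable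
    (condDistrib_ae_eq_of_measure_eq_compProd _ hW.aemeasurable hκ)

/-- Observations that are independent of the past, with an active set selected conditionally
independently of them, have their unconditional law also given the history. -/
lemma condDistrib_history_of_indepFun {F : Type*} [MeasurableSpace F] [StandardBorelSpace F]
    [Nonempty F] {τ : ℕ+ → ℕ∞} {t : ℕ+} {W : Ω → F} (hW : Measurable W)
    (hWp : IndepFun W (M.past t) (M.P τ))
    (hA : CondIndepGiven (M.P τ) (M.pastSigma t) W (M.A t)) :
    ∀ᵐ ω ∂(M.P τ), condDistrib W (M.history t) (M.P τ) (M.history t ω) = (M.P τ).map W := by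
  have := Measure.isProbabilityMeasure_map (μ := M.P τ) hW.aemeasurable
  exact M.condDistrib_history_ae_eq hW (M.map_history_eq_compProd_const hW hWp hA)

end History

lemma regime_top (t : ℕ+) : regime ⊤ t = 0 := by simp [regime]

lemma regime_zero (t : ℕ+) : regime 0 t = 1 := by simp [regime]

/-- Both regimes occur, for suitable change points. -/
lemma exists_regime_eq (l : Fin 2) (t : ℕ+) : ∃ c : ℕ∞, regime c t = l := by
  fin_cases l
  exacts [⟨⊤, regime_top t⟩, ⟨0, regime_zero t⟩]

/-- A density that is a version of the law of `X k t` in each regime has total mass one. -/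
lemma lintegral_eq_one_of_map_eq {Ω E : Type*} [MeasurableSpace Ω] [MeasurableSpace E]
    (M : Model Ω E) {ν : Measure E} {f : Fin 2 → ℕ+ → ℕ+ → E → ℝ≥0∞}
    (hf : ∀ τ k t, (M.P τ).map (M.X k t) = ν.withDensity (f (regime (τ k) t) k t))
    (l : Fin 2) (k t : ℕ+) : ∫⁻ x, f l k t x ∂ν = 1 := by
  obtain ⟨c, hc⟩ := exists_regime_eq l t
  have h := hf (fun _ => c) k t
  have := Measure.isProbabilityMeasure_map (μ := M.P fun _ => c) (M.measurable_X k t).aemeasurable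
  rw [← hc, ← setLIntegral_univ, ← withDensity_apply _ .univ, ← h, measure_univ]

/-! ### Change point densities of the independent, common factor and autoregressive models -/

section Densities

variable {Ω E : Type*} [MeasurableSpace Ω] [MeasurableSpace E] [StandardBorelSpace E]

/-- Observations that are independent of the past and have marginal densities satisfy the change
point density assumption with these densities. -/
lemma hasChangeDensities_of_indep_past [Zero E] [Nonempty E] {M : Model Ω E} {ν : Measure E}
    {f : Fin 2 → ℕ+ → ℕ+ → E → ℝ≥0∞} (hm : ∀ l k t, Measurable (f l k t))
    (hf : ∀ τ k t, (M.P τ).map (M.X k t) = ν.withDensity (f (regime (τ k) t) k t))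
    (hs : ∀ k t, {x | 0 < f 1 k t x} ⊆ {x | 0 < f 0 k t x})
    (hp : ∀ τ k t, IndepFun (M.X k t) (M.past t) (M.P τ))
    {K : ℕ} (hA : M.ActiveSetAssumption K) :
    M.HasChangeDensities ν (fun l k t _ x => f l k t x) where
  measurable_density l k t := (hm l k t).comp measurable_snd
  lintegral_density l k t _ := M.lintegral_eq_one_of_map_eq hf l k t
  support_subset k t _ := hs k t
  conditional_law τ k t := by
    filter_upwards [M.condDistrib_history_of_indepFun (M.measurable_X k t) (hp τ k t)
      (hA.condIndep τ k t)] with ω hω _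
    rw [hω, hf]

end Densities

/-- The observed past is a function of the full past data and the past active sets. -/
lemma IsIndependentModel.indepFun_X_past {Ω E : Type*} [MeasurableSpace Ω]
    [MeasurableSpace E] [Zero E] {M : Model Ω E} {K : ℕ} {ν : Measure E}
    {f : Fin 2 → ℕ+ → ℕ+ → E → ℝ≥0∞} (h : M.IsIndependentModel K ν f) (τ : ℕ+ → ℕ∞) (t : ℕ+) :
    IndepFun (fun ω k => M.X k t ω) (M.past t) (M.P τ) := by
  classical
  have hm : Measurable fun p : PastVal E t =>
      ((fun s k => if k ∈ p.2 s then p.1 s k else 0, p.2) : PastVal E t) := by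
    refine Measurable.prodMk (measurable_pi_lambda _ fun s => measurable_pi_lambda _ fun k =>
      Measurable.ite ?_ (by fun_prop) measurable_const) measurable_snd
    exact measurableSet_mem_of_measurable ((measurable_pi_apply s).comp measurable_snd) k
  exact (h.indep_past τ t).comp measurable_id hm

section CommonFactor

variable {Ω E : Type*} [MeasurableSpace Ω] [NormedAddCommGroup E] [InnerProductSpace ℝ E]
  [FiniteDimensional ℝ E] [MeasurableSpace E] [BorelSpace E] {d₁ : ℕ} {M : Model Ω E} {K : ℕ}
  {Z : ℕ+ → Ω → EuclideanSpace ℝ (Fin d₁)} {ε : ℕ+ → ℕ+ → Ω → E}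
  {h : Fin 2 → ℕ+ → ℕ+ → EuclideanSpace ℝ (Fin d₁) → E}
  {fZ : ℕ+ → EuclideanSpace ℝ (Fin d₁) → ℝ≥0∞} {fε : ℕ+ → ℕ+ → E → ℝ≥0∞}

lemma IsCommonFactorModel.measurable_factorDensity (hM : M.IsCommonFactorModel K Z ε h fZ fε)
    (l : Fin 2) (k t : ℕ+) : Measurable (factorDensity h fZ fε l k t) := by
  have h1 := hM.measurable_h l k t
  have h2 := hM.measurable_fε k t
  have h3 := hM.measurable_fZ t
  refine Measurable.lintegral_prod_right (f := fun x z => fε k t (x - h l k t z) * fZ t z) ?_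
  unfold Function.uncurry
  fun_prop

/-- The density of `h(Z) + ε` is the convolution integral, by Tonelli's theorem. -/
lemma IsCommonFactorModel.map_X (hM : M.IsCommonFactorModel K Z ε h fZ fε)
    (τ : ℕ+ → ℕ∞) (k t : ℕ+) :
    (M.P τ).map (M.X k t) = volume.withDensity (factorDensity h fZ fε (regime (τ k) t) k t) := by
  set l := regime (τ k) t with hl
  have h1 := hM.measurable_h l k t
  have h2 := hM.measurable_fε k t
  have h3 := hM.measurable_fZ t
  have hZ := hM.measurable_Z t
  have hε := hM.measurable_ε k t
  have hX := M.measurable_X k t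
  let g : EuclideanSpace ℝ (Fin d₁) → E → ℝ≥0∞ := fun z x => fε k t (x - h l k t z)
  have hg : Measurable (Function.uncurry g) := by
    change Measurable fun p : EuclideanSpace ℝ (Fin d₁) × E => fε k t (p.2 - h l k t p.1)
    fun_prop
  have : IsMarkovKernel (densityKernel volume g) := isMarkovKernel_densityKernel hg fun z =>
    lintegral_shift_eq_one hε (hM.noise_law τ k t) (h l k t z)
  have hind : IndepFun (ε k t) (Z t) (M.P τ) :=
    ((hM.indep_factor_noise τ).comp (measurable_pi_apply t)
      ((measurable_pi_apply t).comp (measurable_pi_apply k))).symm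
  have key := map_prodMk_eq_compProd_of_shift hZ hε hind h1 (hM.observation τ k t)
    (hM.noise_law τ k t) (κ := densityKernel volume g) (fun z => densityKernel_apply hg z)
  have : IsProbabilityMeasure ((M.P τ).map (Z t)) :=
    Measure.isProbabilityMeasure_map hZ.aemeasurable
  ext s hs
  -- take the second marginal in the disintegration of `(Z t, X k t)` along `Z t`
  have e := congrArg (fun ρ => ρ (Set.univ ×ˢ s)) key
  rw [Measure.map_apply (by fun_prop) (.prod .univ hs), Measure.compProd_apply_prod .univ hs,
    setLIntegral_univ, hM.factor_law, lintegral_withDensity_eq_lintegral_mul _ h3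
      (Kernel.measurable_coe _ hs)] at e
  rw [Measure.map_apply hX hs, withDensity_apply _ hs]
  simp only [factorDensity]
  rw [lintegral_lintegral_swap (by fun_prop)]
  refine (congrArg (M.P τ) (by ext; simp)).trans (e.trans (lintegral_congr fun z => ?_))
  rw [Pi.mul_apply, densityKernel_apply hg, withDensity_apply _ hs, mul_comm,
    lintegral_mul_const _ (by fun_prop)]

lemma IsCommonFactorModel.factorDensity_pos (hM : M.IsCommonFactorModel K Z ε h fZ fε)
    (l : Fin 2) (k t : ℕ+) (x : E) : 0 < factorDensity h fZ fε l k t x := by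
  have h1 := hM.measurable_h l k t
  have h2 := hM.measurable_fε k t
  have h3 := hM.measurable_fZ t
  rw [factorDensity, lintegral_pos_iff_support (by fun_prop)]
  -- the noise density is positive, and the factor density is not almost everywhere zero
  have hs : Function.support (fun z => fε k t (x - h l k t z) * fZ t z)
      = Function.support (fZ t) := by
    ext z
    simp [(hM.noise_support k t (x - h l k t z)).ne']
  rw [hs, ← lintegral_pos_iff_support h3, ← setLIntegral_univ, ← withDensity_apply _ .univ,
    ← hM.factor_law (fun _ => 0) t, Measure.map_apply (hM.measurable_Z t) .univ]
  simp

/-- The observations at time `t` are almost surely a function of the factor and noises at time `t`,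
and the observed past is one of the factors, noises and active sets before `t`. -/
lemma IsCommonFactorModel.indepFun_X_past (hM : M.IsCommonFactorModel K Z ε h fZ fε)
    (τ : ℕ+ → ℕ∞) (t : ℕ+) : IndepFun (fun ω k => M.X k t ω) (M.past t) (M.P τ) := by
  classical
  let φ : EuclideanSpace ℝ (Fin d₁) × (ℕ+ → E) → ℕ+ → E :=
    fun p k => h (regime (τ k) t) k t p.1 + p.2 k
  let ψ : (Set.Iio t → EuclideanSpace ℝ (Fin d₁) × (ℕ+ → E) × Set ℕ+) → PastVal E t :=
    fun q => (fun s k => if k ∈ (q s).2.2 then h (regime (τ k) s) k s (q s).1 + (q s).2.1 k else 0,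
      fun s => (q s).2.2)
  have hφ : Measurable φ := by
    refine measurable_pi_lambda _ fun k => ?_
    have := hM.measurable_h (regime (τ k) t) k t
    fun_prop
  have hψ : Measurable ψ := by
    refine Measurable.prodMk (measurable_pi_lambda _ fun s => measurable_pi_lambda _ fun k =>
      Measurable.ite ?_ ?_ measurable_const) (by fun_prop)
    · exact measurableSet_mem_of_measurable
        (measurable_snd.comp (measurable_snd.comp (measurable_pi_apply s))) k
    · have := hM.measurable_h (regime (τ k) s) k s
      fun_prop
  refine ((hM.indep_past τ t).comp hφ hψ).congr ?_ ?_
  · filter_upwards [ae_all_iff.2 fun k => hM.observation τ k t] with ω hω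
    ext k
    simp [φ, hω k]
  · filter_upwards [ae_all_iff.2 fun k => ae_all_iff.2 fun s => hM.observation τ k s] with ω hω
    refine Prod.ext ?_ rfl
    ext s k
    simp only [ψ, past, observed, Function.comp_apply, hω]

end CommonFactor

section Autoregressive

variable {Ω E : Type*} [MeasurableSpace Ω] [NormedAddCommGroup E] [InnerProductSpace ℝ E]
  [FiniteDimensional ℝ E] [MeasurableSpace E] [BorelSpace E] {d₁ : ℕ} {M : Model Ω E} {K : ℕ}
  {Y : ℕ+ → ℕ+ → Ω → EuclideanSpace ℝ (Fin d₁)} {ε : ℕ+ → ℕ+ → Ω → E}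
  {h : Fin 2 → ℕ+ → ℕ+ → EuclideanSpace ℝ (Fin d₁) → E} {fε : ℕ+ → ℕ+ → E → ℝ≥0∞}

lemma IsAutoregressiveModel.exists_hasChangeDensities
    (hM : M.IsAutoregressiveModel K Y ε h fε) :
    ∃ f : Fin 2 → ℕ+ → (t : ℕ+) → HistVal E t → E → ℝ≥0∞,
      M.HasChangeDensities volume f ∧
      ∀ l k t ω x, f l k t (M.history t ω) x = fε k t (x - h l k t (Y k t ω)) := by
  -- `Y k t` is a function of the past, by the Doob–Dynkin lemma
  have hY : ∀ k t, ∃ g : PastVal E t → EuclideanSpace ℝ (Fin d₁), Measurable g ∧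
      Y k t = g ∘ M.past t := fun k t => (hM.measurable_Y k t).exists_eq_measurable_comp
  choose g hg hgY using hY
  have hh := hM.measurable_h
  have hfε := hM.measurable_fε
  have hp : ∀ l k t, Measurable
      (Function.uncurry fun (p : PastVal E t) (x : E) => fε k t (x - h l k t (g k t p))) := by
    intro l k t
    exact (hfε k t).comp (measurable_snd.sub ((hh l k t).comp ((hg k t).comp measurable_fst)))
  have h1 : ∀ l k t (p : PastVal E t), ∫⁻ x, fε k t (x - h l k t (g k t p)) = 1 :=
    fun l k t p => lintegral_shift_eq_one (hM.measurable_ε k t) (hM.noise_law (fun _ => 0) k t) _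
  refine ⟨fun l k t y x => fε k t (x - h l k t (g k t (pastOfHist y))),
    ⟨fun l k t => ?_, fun l k t y => h1 l k t _, fun k t y x _ => hM.noise_support k t _, ?_⟩, ?_⟩
  · exact (hp l k t).comp ((measurable_pastOfHist.comp measurable_fst).prodMk measurable_snd)
  · intro τ k t
    have : IsMarkovKernel (densityKernel volume fun (p : PastVal E t) (x : E) =>
        fε k t (x - h (regime (τ k) t) k t (g k t p))) :=
      isMarkovKernel_densityKernel (hp _ k t) (h1 _ k t)
    have hind : IndepFun (ε k t) (M.past t) (M.P τ) :=
      (hM.indep_past τ t).comp (measurable_pi_apply k) measurable_id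
    have hobs : ∀ᵐ ω ∂(M.P τ),
        M.X k t ω = h (regime (τ k) t) k t (g k t (M.past t ω)) + ε k t ω := by
      simpa only [hgY, Function.comp_apply] using hM.observation τ k t
    have key := map_prodMk_eq_compProd_of_shift (M.measurable_past t) (hM.measurable_ε k t)
      hind (c := fun p => h (regime (τ k) t) k t (g k t p)) ((hh _ k t).comp (hg k t))
      hobs (hM.noise_law τ k t) (densityKernel_apply (hp _ k t))
    filter_upwards [M.condDistrib_history_ae_eq (M.measurable_X k t) (M.map_history_eq_compProd
      (M.measurable_X k t) key (hM.active.condIndep τ k t))] with ω hω _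
    rw [hω, Kernel.comap_apply, densityKernel_apply (hp _ k t)]
  · intro l k t ω x
    simp only [hgY, Function.comp_apply, pastOfHist_history]

end Autoregressive

end Model

/-! ### The fixed active set model -/

/-- Every random element is conditionally independent of an almost surely constant one. -/
lemma condIndepGiven_of_ae_eq_const {Ω α β : Type*} {m mΩ : MeasurableSpace Ω}
    [MeasurableSpace α] [MeasurableSpace β] {μ : Measure Ω} [IsProbabilityMeasure μ]
    (hm : m ≤ mΩ) (U : Ω → α) {V : Ω → β} {c : β}
    (hV : ∀ᵐ ω ∂μ, V ω = c) : CondIndepGiven μ m U V := by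
  intro S T _ _
  by_cases hc : c ∈ T
  · have hT : V ⁻¹' T =ᵐ[μ] Set.univ := by
      rw [Filter.eventuallyEq_univ]
      filter_upwards [hV] with ω hω
      rwa [Set.mem_preimage, hω]
    have h1 : μ⟦V ⁻¹' T | m⟧ =ᵐ[μ] μ⟦Set.univ | m⟧ :=
      condExp_congr_ae (indicator_ae_eq_of_ae_eq_set hT)
    have h2 : μ⟦U ⁻¹' S ∩ V ⁻¹' T | m⟧ =ᵐ[μ] μ⟦U ⁻¹' S ∩ Set.univ | m⟧ :=
      condExp_congr_ae (indicator_ae_eq_of_ae_eq_set ((ae_eq_refl _).inter hT))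
    rw [Set.indicator_univ, condExp_const hm] at h1
    rw [Set.inter_univ] at h2
    filter_upwards [h1, h2] with ω h1 h2
    rw [h2, Pi.mul_apply, h1, mul_one]
  · have hT : V ⁻¹' T =ᵐ[μ] (∅ : Set Ω) := by
      rw [Filter.eventuallyEq_empty]
      filter_upwards [hV] with ω hω
      rwa [Set.mem_preimage, hω]
    have h1 : μ⟦V ⁻¹' T | m⟧ =ᵐ[μ] μ⟦(∅ : Set Ω) | m⟧ :=
      condExp_congr_ae (indicator_ae_eq_of_ae_eq_set hT)
    have h2 : μ⟦U ⁻¹' S ∩ V ⁻¹' T | m⟧ =ᵐ[μ] μ⟦U ⁻¹' S ∩ ∅ | m⟧ :=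
      condExp_congr_ae (indicator_ae_eq_of_ae_eq_set ((ae_eq_refl _).inter hT))
    rw [Set.indicator_empty, condExp_const hm] at h1
    rw [Set.inter_empty, Set.indicator_empty, condExp_const hm] at h2
    filter_upwards [h1, h2] with ω h1 h2
    rw [h2, Pi.mul_apply, h1, mul_zero]

lemma encard_setOf_le (K : ℕ) : {k : ℕ+ | (k : ℕ) ≤ K}.encard ≤ K := by
  rw [← PNat.coe_injective.encard_image]
  calc ((↑) '' {k : ℕ+ | (k : ℕ) ≤ K} : Set ℕ).encard
      ≤ ((Finset.Icc 1 K : Finset ℕ) : Set ℕ).encard := by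
        refine Set.encard_le_encard ?_
        rintro _ ⟨k, hk, rfl⟩
        exact Finset.mem_coe.2 (Finset.mem_Icc.2 ⟨k.2, hk⟩)
    _ = K := by rw [Set.encard_coe_eq_coe_finsetCard, Nat.card_Icc, Nat.add_sub_cancel]

/-- A kernel that agrees almost surely with the regular conditional distribution, along the
conditioning variable, disintegrates the joint law. -/
lemma map_prodMk_eq_compProd_of_condDistrib_ae_eq {Ω α E : Type*} [MeasurableSpace Ω]
    [MeasurableSpace α] [MeasurableSpace E] [StandardBorelSpace E] [Nonempty E] {μ : Measure Ω}
    [IsProbabilityMeasure μ] {G : Ω → α} {X : Ω → E} (hG : Measurable G) (hX : Measurable X)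
    {κ : Kernel α E} [IsMarkovKernel κ]
    (hκ : ∀ᵐ ω ∂μ, condDistrib X G μ (G ω) = κ (G ω)) :
    μ.map (fun ω => (G ω, X ω)) = μ.map G ⊗ₘ κ := by
  have : IsProbabilityMeasure (μ.map (fun ω => (G ω, X ω))) :=
    Measure.isProbabilityMeasure_map (by fun_prop)
  rw [Measure.ext_prod_iff]
  intro s u hs hu
  rw [← compProd_map_condDistrib hX.aemeasurable, Measure.compProd_apply_prod hs hu,
    Measure.compProd_apply_prod hs hu, setLIntegral_map hs (Kernel.measurable_coe _ hu) hG,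
    setLIntegral_map hs (Kernel.measurable_coe _ hu) hG]
  refine lintegral_congr_ae (ae_restrict_of_ae ?_)
  filter_upwards [hκ] with ω hω
  rw [hω]

namespace Model

section Fixed

variable {Ω E : Type*} [MeasurableSpace Ω] [MeasurableSpace E] [StandardBorelSpace E] [Zero E]
  [Nonempty E] {M : Model Ω E} {K : ℕ} {ν : Measure E}
  {f : Fin 2 → ℕ+ → (t : ℕ+) → FixedVal E K t → E → ℝ≥0∞}

lemma IsFixedActiveSetModel.condIndepGiven (hM : M.IsFixedActiveSetModel K ν f)
    {α : Type*} [MeasurableSpace α] (τ : ℕ+ → ℕ∞) (t : ℕ+) (W : Ω → α) :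
    CondIndepGiven (M.P τ) (M.pastSigma t) W (M.A t) :=
  condIndepGiven_of_ae_eq_const (M.measurable_past t).comap_le W
    ((hM.active_eq τ).mono fun _ hω => hω t)

lemma IsFixedActiveSetModel.activeSetAssumption (hM : M.IsFixedActiveSetModel K ν f) :
    M.ActiveSetAssumption K where
  bounded τ := by
    filter_upwards [hM.active_eq τ] with ω hω t
    rw [hω t]
    exact encard_setOf_le K
  condIndep τ k t := hM.condIndepGiven τ t (M.X k t)

/-- The conditioning on the data array of the sensors `1, …, K` is transferred to the history:
almost surely, the two are functions of each other. -/
lemma IsFixedActiveSetModel.hasChangeDensities [SFinite ν] (hM : M.IsFixedActiveSetModel K ν f) :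
    M.HasChangeDensities ν (fun l k t y x => f l k t (fun s j => y.1 s j) x) where
  measurable_density l k t := by
    refine (hM.measurable_density l k t).comp (Measurable.prodMk ?_ measurable_snd)
    exact measurable_pi_lambda _ fun s => measurable_pi_lambda _ fun j => by fun_prop
  lintegral_density l k t y := hM.lintegral_density l k t _
  support_subset k t y := hM.support_subset k t _
  conditional_law τ k t := by
    by_cases hk : (k : ℕ) ≤ K
    · have hm : Measurable (Function.uncurry (f (regime (τ k) t) k t)) := hM.measurable_density _ k t
      have := isMarkovKernel_densityKernel hm (hM.lintegral_density _ k t)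
      have hG : Measurable fun ω => ((fun s j => M.X j s ω) : FixedVal E K t) :=
        measurable_pi_lambda _ fun s => measurable_pi_lambda _ fun j => M.measurable_X j s
      have hd : Measurable fun y : HistVal E t => ((fun s j => y.1 s j) : FixedVal E K t) :=
        measurable_pi_lambda _ fun s => measurable_pi_lambda _ fun j => by fun_prop
      let e : FixedVal E K t → HistVal E t := fun y =>
        (fun s i => if h : (i : ℕ) ≤ K then y s ⟨i, h⟩ else 0, fun _ => {i | (i : ℕ) ≤ K})
      have he : Measurable e := by
        refine Measurable.prodMk (measurable_pi_lambda _ fun s => measurable_pi_lambda _ fun i => ?_)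
          measurable_const
        by_cases h : (i : ℕ) ≤ K
        · simp only [h, dite_true]; fun_prop
        · simp only [h, dite_false]; fun_prop
      have h1 := map_prodMk_eq_compProd_of_condDistrib_ae_eq (μ := M.P τ)
        (κ := densityKernel ν (f (regime (τ k) t) k t)) hG (M.measurable_X k t) (by
          filter_upwards [hM.conditional_law τ k t hk] with ω hω
          rw [hω, densityKernel_apply hm])
      have h2 := map_prodMk_eq_compProd_of_ae_eq hG (M.measurable_history t) (M.measurable_X k t)
        he hd ?_ ?_ h1
      · filter_upwards [M.condDistrib_history_ae_eq (M.measurable_X k t) h2] with ω hω _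
        rw [hω, Kernel.comap_apply, densityKernel_apply hm]
      · filter_upwards [hM.active_eq τ] with ω hω
        refine Prod.ext ?_ (funext fun s => hω s)
        ext s i
        simp [history, observed, e, hω]
      · filter_upwards [hM.active_eq τ] with ω hω
        ext s j
        simp [history, observed, hω]
    · filter_upwards [hM.active_eq τ] with ω hω hkA
      rw [hω t] at hkA
      exact absurd hkA hk

end Fixed

end Model

/-! ### Positive dependence through a monotone driver -/

/-- If `T` and `W` are independent and `S` is decreasing in its first coordinate, then conditioning
on a smaller upper set of values of `T` makes `(T, W) ∈ S` less likely: on the upper set `D'` every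
section of `S` is smaller than on `D \ D'`. -/
lemma cond_preimage_le_cond_preimage {Ω γ : Type*} [MeasurableSpace Ω] [MeasurableSpace γ]
    {μ : Measure Ω} [IsProbabilityMeasure μ] {T : Ω → ℝ} {W : Ω → γ}
    (hT : Measurable T) (hW : Measurable W) (hTW : IndepFun T W μ)
    {S : Set (ℝ × γ)} (hS : MeasurableSet S)
    (hdec : ∀ s t w, s ≤ t → (t, w) ∈ S → (s, w) ∈ S)
    {D D' : Set ℝ} (hD : MeasurableSet D) (hD' : MeasurableSet D') (hsub : D' ⊆ D)
    (hup : IsUpperSet D') (h0 : μ (T ⁻¹' D') ≠ 0) :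
    μ[(fun ω => (T ω, W ω)) ⁻¹' S | T ⁻¹' D'] ≤ μ[(fun ω => (T ω, W ω)) ⁻¹' S | T ⁻¹' D] := by
  have : IsProbabilityMeasure (μ.map T) := Measure.isProbabilityMeasure_map hT.aemeasurable
  have : IsProbabilityMeasure (μ.map W) := Measure.isProbabilityMeasure_map hW.aemeasurable
  set φ : ℝ → ℝ≥0∞ := fun t => μ.map W (Prod.mk t ⁻¹' S) with hφ
  have hφm : Measurable φ := measurable_measure_prodMk_left hS
  have hanti : Antitone φ := fun s t hst => measure_mono fun w hw => hdec s t w hst hw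
  have hint : ∀ A : Set ℝ, MeasurableSet A →
      μ (T ⁻¹' A ∩ (fun ω => (T ω, W ω)) ⁻¹' S) = ∫⁻ t in A, φ t ∂(μ.map T) := by
    intro A hA
    have hA' : MeasurableSet (A ×ˢ Set.univ ∩ S) := (hA.prod .univ).inter hS
    have h1 : T ⁻¹' A ∩ (fun ω => (T ω, W ω)) ⁻¹' S
        = (fun ω => (T ω, W ω)) ⁻¹' (A ×ˢ Set.univ ∩ S) := by ext; simp
    rw [h1, ← Measure.map_apply (by fun_prop) hA',
      (indepFun_iff_map_prod_eq_prod_map_map hT.aemeasurable hW.aemeasurable).1 hTW,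
      Measure.prod_apply hA', ← lintegral_indicator hA]
    refine lintegral_congr fun t => ?_
    by_cases ht : t ∈ A <;> simp [hφ, ht, Set.preimage]
  have hDmono : μ (T ⁻¹' D') ≤ μ (T ⁻¹' D) := measure_mono (Set.preimage_mono hsub)
  have h0D : μ (T ⁻¹' D) ≠ 0 := fun h => h0 (le_antisymm (hDmono.trans h.le) zero_le)
  -- a value of `φ` separating those on `D'` from those on `D \ D'`
  set m : ℝ≥0∞ := ⨅ t ∈ D \ D', φ t with hm
  have hlow : ∫⁻ t in D', φ t ∂(μ.map T) ≤ m * μ (T ⁻¹' D') := by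
    rw [← Measure.map_apply hT hD', ← setLIntegral_const]
    refine setLIntegral_mono' hD' fun s hs => le_iInf₂ fun t ht => hanti ?_
    exact le_of_not_gt fun hst => ht.2 (hup hst.le hs)
  have hhigh : m * μ (T ⁻¹' (D \ D')) ≤ ∫⁻ t in D \ D', φ t ∂(μ.map T) := by
    rw [← Measure.map_apply hT (hD.diff hD'), ← setLIntegral_const]
    exact setLIntegral_mono' (hD.diff hD') fun t ht => iInf₂_le t ht
  have hsplit : ∫⁻ t in D, φ t ∂(μ.map T)
      = ∫⁻ t in D', φ t ∂(μ.map T) + ∫⁻ t in D \ D', φ t ∂(μ.map T) := by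
    rw [← lintegral_inter_add_sdiff φ D hD', Set.inter_eq_self_of_subset_right hsub]
  have hμsplit : μ (T ⁻¹' D) = μ (T ⁻¹' D') + μ (T ⁻¹' (D \ D')) := by
    rw [← measure_inter_add_sdiff (T ⁻¹' D) (hT hD'), ← Set.preimage_inter,
      Set.inter_eq_self_of_subset_right hsub, Set.preimage_sdiff]
  rw [cond_apply (hT hD'), cond_apply (hT hD), hint D' hD', hint D hD]
  rw [mul_comm, mul_comm (μ (T ⁻¹' D))⁻¹, ← div_eq_mul_inv, ← div_eq_mul_inv]
  rw [ENNReal.div_le_iff h0 (measure_ne_top _ _), ENNReal.mul_div_right_comm.symm,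
    ENNReal.le_div_iff_mul_le (.inl h0D) (.inl (measure_ne_top _ _)), hsplit, hμsplit, mul_add,
    add_mul]
  refine add_le_add le_rfl ?_
  calc (∫⁻ t in D', φ t ∂(μ.map T)) * μ (T ⁻¹' (D \ D'))
      ≤ m * μ (T ⁻¹' D') * μ (T ⁻¹' (D \ D')) := by gcongr
    _ = m * μ (T ⁻¹' (D \ D')) * μ (T ⁻¹' D') := by ring
    _ ≤ _ := by gcongr

/-- A random vector that is a nondecreasing function of a real `T` and of an independent `W`, with
`k`-th coordinate a nondecreasing function of `T` alone, is positively dependent through its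
`k`-th coordinate. -/
lemma antitoneOn_cond_of_monotone_driver {Ω γ ι : Type*} [MeasurableSpace Ω] [MeasurableSpace γ]
    {μ : Measure Ω} [IsProbabilityMeasure μ] {V : Ω → ι → ℝ} (hV : Measurable V)
    {a : Finset ι} {k : ι} {T : Ω → ℝ} {W : Ω → γ}
    (hT : Measurable T) (hW : Measurable W) (hTW : IndepFun T W μ)
    {G : ℝ → γ → a → ℝ} (hG : Measurable (Function.uncurry G)) (hGm : ∀ w, Monotone fun t => G t w)
    (hVG : ∀ᵐ ω ∂μ, (fun j : a => V ω j) = G (T ω) (W ω))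
    {g : ℝ → ℝ} (hg : Monotone g) (hVg : ∀ᵐ ω ∂μ, V ω k = g (T ω))
    {B : Set (a → ℝ)} (hB : MeasurableSet B) (hBl : IsLowerSet B) :
    AntitoneOn (fun x : ℝ => (μ.map V)[{v | (fun j : a => v j) ∈ B} | {v | x ≤ v k}])
      {x : ℝ | 0 ≤ x ∧ μ.map V {v | x ≤ v k} ≠ 0} := by
  have hk : ∀ x : ℝ, MeasurableSet {v : ι → ℝ | x ≤ v k} := fun x =>
    measurableSet_le measurable_const (measurable_pi_apply k)
  have hBm : MeasurableSet {v : ι → ℝ | (fun j : a => v j) ∈ B} :=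
    (measurable_pi_lambda _ fun j : a => measurable_pi_apply (j : ι)) hB
  have hset : ∀ x : ℝ, V ⁻¹' {v | x ≤ v k} =ᵐ[μ] T ⁻¹' {t | x ≤ g t} := by
    intro x
    filter_upwards [hVg] with ω hω
    change (x ≤ V ω k) = (x ≤ g (T ω))
    rw [hω]
  have hsetB : V ⁻¹' {v | (fun j : a => v j) ∈ B}
      =ᵐ[μ] (fun ω => (T ω, W ω)) ⁻¹' (Function.uncurry G ⁻¹' B) := by
    filter_upwards [hVG] with ω hω
    change ((fun j : a => V ω j) ∈ B) = (G (T ω) (W ω) ∈ B)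
    rw [hω]
  have hDm : ∀ x, MeasurableSet {t | x ≤ g t} := fun x =>
    measurableSet_le measurable_const hg.measurable
  have hcond : ∀ x : ℝ, (μ.map V)[{v | (fun j : a => v j) ∈ B} | {v | x ≤ v k}]
      = μ[(fun ω => (T ω, W ω)) ⁻¹' (Function.uncurry G ⁻¹' B) | T ⁻¹' {t | x ≤ g t}] := by
    intro x
    rw [cond_apply (hk x), cond_apply (hT (hDm x)), Measure.map_apply hV (hk x),
      Measure.map_apply hV ((hk x).inter hBm), measure_congr (hset x), Set.preimage_inter,
      measure_congr ((hset x).inter hsetB)]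
  intro x _ y hy hxy
  simp only [hcond]
  refine cond_preimage_le_cond_preimage hT hW hTW (hG hB) ?_ (hDm x) (hDm y)
    (fun t ht => hxy.trans ht) (fun s t hst hs => le_trans hs (hg hst)) ?_
  · exact fun s t w hst ht => hBl (hGm w hst) ht
  · rw [← measure_congr (hset y), ← Measure.map_apply hV (hk y)]
    exact hy.2

lemma CondIndepGiven.comp_left {Ω α α' β : Type*} {m _ : MeasurableSpace Ω}
    [MeasurableSpace α] [MeasurableSpace α'] [MeasurableSpace β] {μ : Measure Ω} {U : Ω → α}
    {V : Ω → β} (h : CondIndepGiven μ m U V) {g : α → α'} (hg : Measurable g) :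
    CondIndepGiven μ m (g ∘ U) V :=
  fun S T hS hT => h (g ⁻¹' S) T (hg hS) hT

namespace Model

section PositiveDependence

variable {Ω : Type*} [MeasurableSpace Ω] {M : Model Ω ℝ} {f : Fin 2 → ℕ+ → ℕ+ → ℝ → ℝ≥0∞}

lemma measurable_likelihoodRatio_map (hf : ∀ l k t, Measurable (f l k t)) (t : ℕ+) :
    Measurable fun (x : ℕ+ → ℝ) (k : ℕ+) => (f 1 k t (x k) / f 0 k t (x k)).toReal := by
  refine measurable_pi_lambda _ fun k => ?_
  have := hf 1 k t
  have := hf 0 k t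
  fun_prop

lemma measurable_likelihoodRatio (hf : ∀ l k t, Measurable (f l k t)) (t : ℕ+) :
    Measurable (M.likelihoodRatio (fun l k t _ x => f l k t x) t) :=
  (measurable_likelihoodRatio_map hf t).comp (measurable_pi_lambda _ fun k => M.measurable_X k t)

/-- If the observations at each time are independent of the past, the positive dependence has to be
checked for the unconditional law of the likelihood ratios only. -/
lemma tipd_of_indep_past (hf : ∀ l k t, Measurable (f l k t))
    (hp : ∀ τ t, IndepFun (fun ω k => M.X k t ω) (M.past t) (M.P τ)) (hJ : M.JointSelection)
    (hpd : ∀ τ t (a : Finset ℕ+), ∀ k ∈ a, ∀ B : Set (a → ℝ), MeasurableSet B → IsLowerSet B →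
      AntitoneOn (fun x : ℝ => ((M.P τ).map (M.likelihoodRatio (fun l k t _ x => f l k t x) t))[
          {v | (fun j : a => v j) ∈ B} | {v | x ≤ v k}])
        {x : ℝ | 0 ≤ x ∧
          (M.P τ).map (M.likelihoodRatio (fun l k t _ x => f l k t x) t) {v | x ≤ v k} ≠ 0}) :
    M.TIPD (fun l k t _ x => f l k t x) where
  time_independence τ k t := (hp τ t).comp (measurable_pi_apply k) measurable_id
  positive_dependence τ t := by
    have hg := measurable_likelihoodRatio_map hf t
    filter_upwards [M.condDistrib_history_of_indepFun (measurable_likelihoodRatio hf t)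
      ((hp τ t).comp hg measurable_id) ((hJ τ t).comp_left hg)] with ω hω a _ k hk B hB hBl
    have h := hpd τ t a k hk B hB hBl
    rw [← hω] at h
    exact h

/-- The likelihood ratios of an independent model are independent, so that the one of sensor `k`
can itself serve as the driver, with the ratios of the other sensors as the independent part. -/
lemma IsIndependentModel.tipd {K : ℕ} {ν : Measure ℝ} (hM : M.IsIndependentModel K ν f)
    (hJ : M.JointSelection) : M.TIPD (fun l k t _ x => f l k t x) := by
  have hf := hM.measurable_density
  refine tipd_of_indep_past hf hM.indepFun_X_past hJ fun τ t a k hk B hB hBl => ?_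
  set V := M.likelihoodRatio (fun l k t _ x => f l k t x) t with hVdef
  have hV : Measurable V := measurable_likelihoodRatio hf t
  have hVk : ∀ j, Measurable fun ω => V ω j := fun j => (measurable_pi_apply j).comp hV
  have hind : iIndepFun (fun j ω => V ω j) (M.P τ) :=
    (hM.indep_sensors τ t).comp (fun j x => (f 1 j t x / f 0 j t x).toReal) fun j => by
      have := hf 1 j t
      have := hf 0 j t
      fun_prop
  have hTW : IndepFun (fun ω => V ω k) (fun ω (j : a.erase k) => V ω j) (M.P τ) :=
    (hind.indepFun_finset {k} (a.erase k) (by simp) hVk).comp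
      (measurable_pi_apply (⟨k, by simp⟩ : ({k} : Finset ℕ+))) measurable_id
  classical
  let G : ℝ → (a.erase k → ℝ) → a → ℝ := fun s w j =>
    if h : (j : ℕ+) = k then s else w ⟨j, Finset.mem_erase.2 ⟨h, j.2⟩⟩
  refine antitoneOn_cond_of_monotone_driver hV (hVk k)
    (W := fun ω (j : a.erase k) => V ω j) (measurable_pi_lambda _ fun j => hVk j) hTW (G := G)
    ?_ ?_ (.of_forall fun ω => ?_) monotone_id (.of_forall fun ω => rfl) hB hBl
  · refine measurable_pi_lambda _ fun j => ?_
    by_cases h : (j : ℕ+) = k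
    · simpa only [G, Function.uncurry, h, dite_true] using measurable_fst
    · simp only [G, Function.uncurry, h, dite_false]
      fun_prop
  · intro w s s' hs j
    by_cases h : (j : ℕ+) = k <;> simp [G, h, hs]
  · ext j
    by_cases h : (j : ℕ+) = k <;> simp [G, h]

end PositiveDependence

end Model

/-! ### Gaussian observations -/

lemma gaussianPDF_div_gaussianPDF (m₀ m₁ : ℝ) {v : NNReal} (hv : v ≠ 0) (x : ℝ) :
    (gaussianPDF m₁ v x / gaussianPDF m₀ v x).toReal
      = Real.exp (((m₁ - m₀) * x) / v + (m₀ ^ 2 - m₁ ^ 2) / (2 * v)) := by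
  have hv' : (v : ℝ) ≠ 0 := by exact_mod_cast hv
  have h2 : (√(2 * Real.pi * v))⁻¹ ≠ 0 := by positivity
  rw [ENNReal.toReal_div, toReal_gaussianPDF, toReal_gaussianPDF, gaussianPDFReal, gaussianPDFReal,
    mul_div_mul_left _ _ h2, ← Real.exp_sub]
  congr 1
  field_simp
  ring

/-- In a Gaussian process, the residuals `X j - c j * X k` of the regressions on `X k` are
independent of `X k`. -/
lemma indepFun_regression_residual {Ω ι : Type*} [MeasurableSpace Ω] {μ : Measure Ω}
    {X : ι → Ω → ℝ} (hX : IsGaussianProcess X μ) (hXm : ∀ j, Measurable (X j)) (k : ι)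
    (hk : Var[X k; μ] ≠ 0) :
    IndepFun (X k) (fun ω j => X j ω - cov[X j, X k; μ] / Var[X k; μ] * X k ω) μ := by
  classical
  have := hX.isProbabilityMeasure
  set c : ι → ℝ := fun j => cov[X j, X k; μ] / Var[X k; μ] with hc
  have hjoint : IsGaussianProcess
      (Sum.elim (fun _ : Unit => X k) fun j ω => X j ω - c j * X k ω) μ := by
    refine hX.of_isGaussianProcess fun s => ?_
    rcases s with _ | j
    · exact ⟨{k}, ContinuousLinearMap.proj ⟨k, by simp⟩, fun ω => by simp⟩
    · exact ⟨{j, k}, ContinuousLinearMap.proj ⟨j, by simp⟩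
        - c j • ContinuousLinearMap.proj ⟨k, by simp⟩, fun ω => by simp⟩
  have hL2 : ∀ j, MemLp (X j) 2 μ := fun j => (hX.hasGaussianLaw_eval j).memLp_two
  refine (hjoint.indepFun_of_covariance_eq_zero (fun _ => (hXm k).aemeasurable)
    (fun j => ((hXm j).sub ((hXm k).const_mul _)).aemeasurable) fun _ j => ?_).comp
      (measurable_pi_apply ()) measurable_id
  rw [covariance_fun_sub_right (hL2 k) (hL2 j) ((hL2 k).const_mul _), covariance_const_mul_right,
    covariance_self (hXm k).aemeasurable, covariance_comm, hc]
  field_simp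
  ring

namespace Model

section Gaussian

variable {Ω : Type*} [MeasurableSpace Ω] {M : Model Ω ℝ} {f : Fin 2 → ℕ+ → ℕ+ → ℝ → ℝ≥0∞}
  {δ : Fin 2 → ℝ}

lemma IsPositiveGaussianField.hasGaussianLaw (hG : M.IsPositiveGaussianField δ) (τ : ℕ+ → ℕ∞)
    (k t : ℕ+) : HasGaussianLaw (M.X k t) (M.P τ) :=
  (hG.gaussian τ).hasGaussianLaw_eval (k, t)

/-- The existence of a Lebesgue density excludes degenerate Gaussian observations. -/
lemma IsPositiveGaussianField.variance_toNNReal_ne_zero (hG : M.IsPositiveGaussianField δ)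
    (hlaw : ∀ τ k t, (M.P τ).map (M.X k t) = volume.withDensity (f (regime (τ k) t) k t))
    (τ : ℕ+ → ℕ∞) (k t : ℕ+) : Var[M.X k t; M.P τ].toNNReal ≠ 0 := by
  intro h0
  have h := (hG.hasGaussianLaw τ k t).map_eq_gaussianReal
  rw [h0, gaussianReal_zero_var, hlaw] at h
  have h1 := withDensity_absolutelyContinuous volume (f (regime (τ k) t) k t)
    (Real.volume_singleton (a := ∫ ω, M.X k t ω ∂(M.P τ)))
  rw [h] at h1
  simp at h1

/-- Any densities of the observations agree almost everywhere with the Gaussian ones. -/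
lemma IsPositiveGaussianField.density_ae_eq (hG : M.IsPositiveGaussianField δ)
    (hf : ∀ l k t, Measurable (f l k t))
    (hlaw : ∀ τ k t, (M.P τ).map (M.X k t) = volume.withDensity (f (regime (τ k) t) k t))
    (τ : ℕ+ → ℕ∞) (l : Fin 2) (k t : ℕ+) :
    f l k t =ᵐ[volume] gaussianPDF (δ l) Var[M.X k t; M.P τ].toNNReal := by
  -- use change points for which regime `l` holds at time `t`; the variance is the same as under `τ`
  obtain ⟨c, hc⟩ := exists_regime_eq l t
  have h := (hG.hasGaussianLaw (fun _ => c) k t).map_eq_gaussianReal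
  rw [hlaw, hG.mean, hc, hG.variance_eq _ τ, gaussianReal_of_var_ne_zero _
    (hG.variance_toNNReal_ne_zero hlaw τ k t)] at h
  exact (withDensity_eq_iff_of_sigmaFinite (hf l k t).aemeasurable
    (measurable_gaussianPDF _ _).aemeasurable).1 h

/-- Since the two regimes differ in the mean only, the likelihood ratio is the exponential of an
affine function of the observation. -/
lemma IsPositiveGaussianField.likelihoodRatio_ae_eq (hG : M.IsPositiveGaussianField δ)
    (hf : ∀ l k t, Measurable (f l k t))
    (hlaw : ∀ τ k t, (M.P τ).map (M.X k t) = volume.withDensity (f (regime (τ k) t) k t))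
    (τ : ℕ+ → ℕ∞) (t : ℕ+) :
    ∀ᵐ ω ∂(M.P τ), ∀ k, M.likelihoodRatio (fun l k t _ x => f l k t x) t ω k
      = Real.exp (((δ 1 - δ 0) * M.X k t ω) / Var[M.X k t; M.P τ]
          + (δ 0 ^ 2 - δ 1 ^ 2) / (2 * Var[M.X k t; M.P τ])) := by
  refine ae_all_iff.2 fun k => ?_
  have hac : (M.P τ).map (M.X k t) ≪ volume := by
    rw [hlaw]; exact withDensity_absolutelyContinuous _ _
  have h0 := ae_of_ae_map (M.measurable_X k t).aemeasurable
    (hac.ae_le (hG.density_ae_eq hf hlaw τ 0 k t))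
  have h1 := ae_of_ae_map (M.measurable_X k t).aemeasurable
    (hac.ae_le (hG.density_ae_eq hf hlaw τ 1 k t))
  filter_upwards [h0, h1] with ω h0 h1
  rw [likelihoodRatio, h0, h1, gaussianPDF_div_gaussianPDF _ _
    (hG.variance_toNNReal_ne_zero hlaw τ k t), Real.coe_toNNReal _ (variance_nonneg _ _)]

/-- The driver of the likelihood ratios is `(δ 1 - δ 0) * X k t`: the other observations are the sum
of a nonnegative multiple of `X k t` and of an independent residual. -/
lemma IsPositiveGaussianField.tipd (hG : M.IsPositiveGaussianField δ)
    (hf : ∀ l k t, Measurable (f l k t))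
    (hlaw : ∀ τ k t, (M.P τ).map (M.X k t) = volume.withDensity (f (regime (τ k) t) k t))
    (hp : ∀ τ t, IndepFun (fun ω k => M.X k t ω) (M.past t) (M.P τ)) (hJ : M.JointSelection) :
    M.TIPD (fun l k t _ x => f l k t x) := by
  refine tipd_of_indep_past hf hp hJ fun τ t a k _ B hB hBl => ?_
  have hvar : ∀ j, 0 < Var[M.X j t; M.P τ] := fun j =>
    Real.toNNReal_pos.1 (pos_iff_ne_zero.2 (hG.variance_toNNReal_ne_zero hlaw τ j t))
  have hLR := hG.likelihoodRatio_ae_eq hf hlaw τ t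
  set c : ℕ+ → ℝ := fun j => cov[M.X j t, M.X k t; M.P τ] / Var[M.X k t; M.P τ] with hc
  have hc0 : ∀ j, 0 ≤ c j := fun j => div_nonneg (hG.cov_nonneg τ j k t) (hvar k).le
  have hXt : IsGaussianProcess (fun j => M.X j t) (M.P τ) :=
    (hG.gaussian τ).comp_right fun j => (j, t)
  have hTW : IndepFun (fun ω => (δ 1 - δ 0) * M.X k t ω)
      (fun ω j => M.X j t ω - c j * M.X k t ω) (M.P τ) :=
    (indepFun_regression_residual hXt (fun j => M.measurable_X j t) k (hvar k).ne').comp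
      (measurable_const_mul (δ 1 - δ 0)) measurable_id
  let b : ℕ+ → ℝ := fun j => (δ 0 ^ 2 - δ 1 ^ 2) / (2 * Var[M.X j t; M.P τ])
  let G : ℝ → (ℕ+ → ℝ) → a → ℝ := fun s w j =>
    Real.exp ((c j * s + (δ 1 - δ 0) * w j) / Var[M.X j t; M.P τ] + b j)
  refine antitoneOn_cond_of_monotone_driver (measurable_likelihoodRatio hf t)
    ((M.measurable_X k t).const_mul _) (W := fun ω j => M.X j t ω - c j * M.X k t ω)
    (measurable_pi_lambda _ fun j =>
      (M.measurable_X j t).sub ((M.measurable_X k t).const_mul _)) hTW (G := G) ?_ ?_ ?_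
    (g := fun s => Real.exp (s / Var[M.X k t; M.P τ] + b k)) ?_ ?_ hB hBl
  · refine measurable_pi_lambda _ fun j => ?_
    simp only [G, Function.uncurry]
    fun_prop
  · intro w s s' hs j
    have := hc0 j
    have := (hvar j).le
    simp only [G]
    gcongr
  · filter_upwards [hLR] with ω hω
    ext j
    simp only [hω, G, b]
    congr 3
    ring
  · intro s s' hs
    have := (hvar k).le
    simp only
    gcongr
  · filter_upwards [hLR] with ω hω
    rw [hω]

end Gaussian

end Model

end SensorNetwork

theorem theorem5 {Ω : Type*} [MeasurableSpace Ω] {E : Type*} [NormedAddCommGroup E]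
    [InnerProductSpace ℝ E] [FiniteDimensional ℝ E] [MeasurableSpace E] [BorelSpace E]
    (d₁ K : ℕ) :
    -- the independent model: change point density assumption
    (∀ (M : SensorNetwork.Model Ω E) (ν : Measure E) [SigmaFinite ν]
        (f : Fin 2 → ℕ+ → ℕ+ → E → ℝ≥0∞),
      M.IsIndependentModel K ν f →
        M.HasChangeDensities ν (fun l k t _ x => f l k t x)) ∧
    -- the common factor model: change point density assumption
    (∀ (M : SensorNetwork.Model Ω E) (Z : ℕ+ → Ω → EuclideanSpace ℝ (Fin d₁))
        (ε : ℕ+ → ℕ+ → Ω → E) (h : Fin 2 → ℕ+ → ℕ+ → EuclideanSpace ℝ (Fin d₁) → E)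
        (fZ : ℕ+ → EuclideanSpace ℝ (Fin d₁) → ℝ≥0∞) (fε : ℕ+ → ℕ+ → E → ℝ≥0∞),
      M.IsCommonFactorModel K Z ε h fZ fε →
        M.HasChangeDensities volume
          (fun l k t _ x => SensorNetwork.Model.factorDensity h fZ fε l k t x)) ∧
    -- the autoregressive type model: change point density assumption
    (∀ (M : SensorNetwork.Model Ω E) (Y : ℕ+ → ℕ+ → Ω → EuclideanSpace ℝ (Fin d₁))
        (ε : ℕ+ → ℕ+ → Ω → E) (h : Fin 2 → ℕ+ → ℕ+ → EuclideanSpace ℝ (Fin d₁) → E)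
        (fε : ℕ+ → ℕ+ → E → ℝ≥0∞),
      M.IsAutoregressiveModel K Y ε h fε →
        ∃ f : Fin 2 → ℕ+ → (t : ℕ+) → SensorNetwork.HistVal E t → E → ℝ≥0∞,
          M.HasChangeDensities volume f ∧
          ∀ l k t ω x, f l k t (M.history t ω) x = fε k t (x - h l k t (Y k t ω))) ∧
    -- the fixed active set model: change point density assumption and active set assumption
    (∀ (M : SensorNetwork.Model Ω E) (ν : Measure E) [SigmaFinite ν]
        (f : Fin 2 → ℕ+ → (t : ℕ+) → SensorNetwork.Model.FixedVal E K t → E → ℝ≥0∞),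
      M.IsFixedActiveSetModel K ν f →
        M.HasChangeDensities ν (fun l k t y x => f l k t (fun s j => y.1 s j) x) ∧
        M.ActiveSetAssumption K ∧ M.JointSelection) ∧
    -- time independent positive dependence: real observations, independent model with
    -- monotone likelihood ratios
    (∀ (M : SensorNetwork.Model Ω ℝ) (ν : Measure ℝ) [SigmaFinite ν]
        (f : Fin 2 → ℕ+ → ℕ+ → ℝ → ℝ≥0∞),
      M.IsIndependentModel K ν f → M.JointSelection →
      (∀ k t, ∃ ξ : ℝ → ℝ≥0∞, (Monotone ξ ∨ Antitone ξ) ∧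
        ∀ x, 0 < f 0 k t x → f 1 k t x / f 0 k t x = ξ x) →
        M.TIPD (fun l k t _ x => f l k t x)) ∧
    -- time independent positive dependence: Gaussian random field
    (∀ (M : SensorNetwork.Model Ω ℝ) (Z : ℕ+ → Ω → EuclideanSpace ℝ (Fin d₁))
        (ε : ℕ+ → ℕ+ → Ω → ℝ) (h : Fin 2 → ℕ+ → ℕ+ → EuclideanSpace ℝ (Fin d₁) → ℝ)
        (fZ : ℕ+ → EuclideanSpace ℝ (Fin d₁) → ℝ≥0∞) (fε : ℕ+ → ℕ+ → ℝ → ℝ≥0∞)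
        (δ : Fin 2 → ℝ),
      M.IsCommonFactorModel K Z ε h fZ fε → M.JointSelection →
      M.IsPositiveGaussianField δ →
        M.TIPD (fun l k t _ x => SensorNetwork.Model.factorDensity h fZ fε l k t x)) := by
  refine ⟨fun M ν _ f hM => ?_, fun M Z ε h fZ fε hM => ?_, fun M Y ε h fε hM => ?_,
    fun M ν _ f hM => ?_, fun M ν _ f hM hJ _ => ?_, fun M Z ε h fZ fε δ hM hJ hG => ?_⟩
  · exact SensorNetwork.Model.hasChangeDensities_of_indep_past hM.measurable_density
      hM.marginal_law hM.support_subset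
      (fun τ k t => (hM.indepFun_X_past τ t).comp (measurable_pi_apply k) measurable_id) hM.active
  · exact SensorNetwork.Model.hasChangeDensities_of_indep_past hM.measurable_factorDensity
      hM.map_X (fun k t x _ => hM.factorDensity_pos 0 k t x)
      (fun τ k t => (hM.indepFun_X_past τ t).comp (measurable_pi_apply k) measurable_id) hM.active
  · exact hM.exists_hasChangeDensities
  · exact ⟨hM.hasChangeDensities, hM.activeSetAssumption, fun τ t => hM.condIndepGiven τ t _⟩
  · exact hM.tipd hJ
  · exact hG.tipd hM.measurable_factorDensity hM.map_X hM.indepFun_X_past hJ
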